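/- Let $n\ge 1$ and let $\mathbb{R}^{2^n}$ have the computational basis $|y_1\dots y_n\rangle$, $y_k\in\{0,1\}$. Let $H=\frac1{\sqrt2}\begin{pmatrix}1&1\\1&-1\end{pmatrix}$, let $Z=\mathrm{diag}(1,-1)$, and let $P$ be the cyclic shift of the qubits, $P|y_1y_2\dots y_n\rangle=|y_2\dots y_ny_1\rangle$. Put $V_n=P\cdot(H\otimes I^{\otimes n-1})$. For $i\in\{1,\dots,2^n\}$ let $P_n(i)$ be the diagonal matrix with entry $-1$ at the $i$-th basis vector and $1$ elsewhere, and for $j\in\{1,\dots,n\}$ let $F_n(j)$ be $Z$ on the $j$-th qubit and the identity on all others. Theorem. For every $n\ge1$ and every fixed $i\in\{1,\dots,2^n\}$ and $j\in\{1,\dots,n\}$, the set $B=\{V_n,P_n(i),F_n(j)\}$ is universal for quantum computation on $n$ qubits, in the following sense. (0) $V_n^{\,n}=H^{\otimes n}$; the elements of $B$ are real orthogonal matrices, and they are three distinct ones if $n\ge2$. (1) The set $\langle B\rangle$ of all finite words (products) in $B$ contains all diagonal matrices with entries $\pm1$ and all $2^n\times2^n$ permutation matrices. (2) $\langle B\rangle$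 contains exactly every $n$-qubit circuit composed of Hadamard gates on arbitrary qubits and Toffoli gates on arbitrary triples of distinct qubits. (3) If $n\ge3$, then $\langle B\rangle$ is dense in the real orthogonal group: its closure is $O(2^n)$. Consequently $\langle B\rangle$ simulates all quantum computation on $n-1$ qubits: choose any qubit $a$, and encode a complex state $\psi$ of the other $n-1$ qubits as the real $n$-qubit state $E_a(\psi)=\mathrm{Re}\,\psi\otimes|0\rangle+\mathrm{Im}\,\psi\otimes|1\rangle$ (second factor in qubit $a$). Then for every $2^{n-1}\times2^{n-1}$ unitary $U$ and every $\varepsilon>0$ there is $W\in\langle B\rangle$ with $\|W E_a(\psi)-E_a(U\psi)\|\le\varepsilon\|\psi\|$ for all $\psi$. -/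

import Mathlib

noncomputable section

namespace UnlabeledQubits

/-- Labels of the computational basis of `n` qubits: `x k` is the value of qubit `k`, and qubit `0`
is the leftmost tensor factor (the most significant bit). -/
abbrev Basis (n : ℕ) : Type := Fin n → Fin 2

/-- Real matrices acting on `n` qubits, in the computational basis. -/
abbrev Gate (n : ℕ) : Type := Matrix (Basis n) (Basis n) ℝ

/-- The one-qubit Hadamard gate. -/
def hadamard : Matrix (Fin 2) (Fin 2) ℝ :=
  (1 / Real.sqrt 2) • !![1, 1; 1, -1]

/-- The Pauli matrix `Z`. -/
def pauliZ : Matrix (Fin 2) (Fin 2) ℝ := !![1, 0; 0, -1]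

/-- The tensor (Kronecker) product `A 0 ⊗ A 1 ⊗ ⋯ ⊗ A (n - 1)` of one-qubit matrices. -/
def tensor {n : ℕ} (A : Fin n → Matrix (Fin 2) (Fin 2) ℝ) : Gate n :=
  Matrix.of fun x y => ∏ k, A k (x k) (y k)

/-- The matrix `A` acting on qubit `k`, tensored with the identity on all other qubits. -/
def onQubit {n : ℕ} (k : Fin n) (A : Matrix (Fin 2) (Fin 2) ℝ) : Gate n :=
  tensor (Function.update (fun _ => 1) k A)

/-- The matrix that maps the basis vector `|y⟩` to `|f y⟩`. -/
def basisMap {n : ℕ} (f : Basis n → Basis n) : Gate n :=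
  Matrix.of fun x y => if x = f y then 1 else 0

/-- The cyclic shift of the qubits, `|y₀ y₁ … yₙ₋₁⟩ ↦ |y₁ … yₙ₋₁ y₀⟩`. -/
def shift (n : ℕ) : Gate n :=
  basisMap fun y k => y (finRotate n k)

/-- `Vₙ = P (H ⊗ I ⊗ ⋯ ⊗ I)`, with `P` the cyclic shift of the qubits. -/
def V (n : ℕ) [NeZero n] : Gate n :=
  shift n * onQubit 0 hadamard

/-- The diagonal matrix that changes the sign of the single basis vector `|i⟩`. -/
def phaseFlip {n : ℕ} (i : Basis n) : Gate n :=
  Matrix.diagonal fun x => if x = i then -1 else 1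

/-- `Z` on qubit `j`, the identity on the other qubits. -/
def qubitFlip {n : ℕ} (j : Fin n) : Gate n := onQubit j pauliZ

/-- The alphabet `B = {Vₙ, Pₙ(i), Fₙ(j)}`. -/
def alphabet (n : ℕ) [NeZero n] (i : Basis n) (j : Fin n) : Set (Gate n) :=
  {V n, phaseFlip i, qubitFlip j}

/-- All finite words (products) in the letters of `S`. -/
def words {n : ℕ} (S : Set (Gate n)) : Submonoid (Gate n) := Submonoid.closure S

/-- The Toffoli gate with controls `a`, `b` and target `c`: it maps the bit `y c` to
`y c ⊕ y a * y b` (arithmetic in `Fin 2` is modulo `2`) and fixes the other bits. -/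
def toffoli {n : ℕ} (a b c : Fin n) : Gate n :=
  basisMap fun y => Function.update y c (y c + y a * y b)

/-- Hadamard gates on any qubit and Toffoli gates on any three distinct qubits. -/
def hadamardToffoli (n : ℕ) : Set (Gate n) :=
  {M | ∃ k : Fin n, M = onQubit k hadamard} ∪
    {M | ∃ a b c : Fin n, a ≠ b ∧ a ≠ c ∧ b ≠ c ∧ M = toffoli a b c}

/-- The qubits other than `a`. -/
abbrev Rest {n : ℕ} (a : Fin n) : Type := {l : Fin n // l ≠ a} → Fin 2

/-- A complex state `ψ` of the qubits other than `a`, written as a real state of all `n` qubits: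
`Re ψ ⊗ |0⟩ + Im ψ ⊗ |1⟩`, with the last factor in qubit `a`. Measuring the qubits other than `a`
has the same outcome distribution in both states. -/
def encode {n : ℕ} (a : Fin n) (ψ : Rest a → ℂ) : Basis n → ℝ :=
  fun x => if x a = 0 then (ψ fun l => x l).re else (ψ fun l => x l).im

/-- Words in `S` simulate every unitary operation on `n - 1` qubits to any accuracy, the complex
amplitudes being encoded with the help of the remaining qubit (which may be any of the `n`). The
error is measured in Euclidean norm, uniformly over all states. -/
def SimulatesUnitaries {n : ℕ} (S : Set (Gate n)) : Prop :=
  ∀ (a : Fin n) (U : Matrix (Rest a) (Rest a) ℂ), U ∈ Matrix.unitaryGroup (Rest a) ℂ →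
    ∀ ε : ℝ, 0 < ε → ∃ W ∈ words S, ∀ ψ : Rest a → ℂ,
      ∑ x, ((W.mulVec (encode a ψ)) x - encode a (U.mulVec ψ) x) ^ 2 ≤ ε ^ 2 * ∑ y, ‖ψ y‖ ^ 2

end UnlabeledQubits

end

noncomputable section

namespace UnlabeledQubits

open Matrix Function

/-! ### Matrix calculus of tensor products, basis maps and qubit permutations -/

section Calculus

variable {n : ℕ}

/-! Since `V n` has order dividing `2 * n`, its inverse is a word. Conjugation by `V n` moves a gate
one qubit down as long as it commutes with the Hadamard gate on qubit `0`; a gate that passes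
through qubit `0` reappears on the last qubit conjugated by Hadamard. So `Z` on qubit `j` descends
to qubit `0`, turns into `X` on the last qubit, and descends to every qubit. The `X` gates carry the
one sign flip to every basis vector, which gives all sign matrices. Conjugating controlled `Z` gates
by `V n` or its inverse gives controlled negations, hence qubit swaps (`relabel_mem`), hence the
shift itself; cancelling it from `V n` isolates the Hadamard gate. Hadamard conjugates of sign flips
are transpositions along the edges of the hypercube, and these generate all permutations.

For density, two Hadamard gates turn a coordinate reflection into the reflection of a 0-1 vector
with four ones. Signed permutations of that vector include pairs at an angle of cosine 1/4, an
irrational multiple of `π` by Niven's theorem, so reflections become dense in the planes of such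
pairs. Given a unit vector `x`, let `y` be the point closest to `x` in the orbit of a coordinate
vector under the compact closure. No reflection in the monoid brings `y` closer, so `(y ⬝ᵥ w) * (x
⬝ᵥ w)` is nonnegative on all those planes, which forces `x = ± y`. Thus the closure is transitive on
the sphere, contains every hyperplane reflection, and is the whole orthogonal group. Complex
unitaries embed there by separating real and imaginary parts. -/

theorem basisMap_apply (f : Basis n → Basis n) (x y : Basis n) :
    basisMap f x y = if x = f y then 1 else 0 := rfl

theorem tensor_apply (A : Fin n → Matrix (Fin 2) (Fin 2) ℝ) (x y : Basis n) :
    tensor A x y = ∏ k, A k (x k) (y k) := rfl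

theorem basisMap_mul (f g : Basis n → Basis n) : basisMap f * basisMap g = basisMap (f ∘ g) := by
  ext x y
  simp [basisMap_apply, mul_apply]

theorem basisMap_id : basisMap (id : Basis n → Basis n) = 1 := by
  ext x y
  simp [basisMap_apply, one_apply]

theorem basisMap_perm_transpose (σ : Equiv.Perm (Basis n)) :
    (basisMap σ)ᵀ = basisMap σ.symm := by
  ext x y
  simp only [transpose_apply, basisMap_apply]
  exact if_congr (by rw [Equiv.eq_symm_apply, eq_comm]) rfl rfl

theorem permMatrix_eq_basisMap (σ : Equiv.Perm (Basis n)) :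
    Equiv.Perm.permMatrix ℝ σ = basisMap σ.symm := by
  ext x y
  simp only [Equiv.Perm.permMatrix, PEquiv.toMatrix_apply, Equiv.toPEquiv_apply, basisMap_apply,
    Option.mem_some_iff]
  exact if_congr (by rw [Equiv.eq_symm_apply, eq_comm, eq_comm]) rfl rfl

theorem basisMap_mul_diagonal_mul (σ : Equiv.Perm (Basis n)) (d : Basis n → ℝ) :
    basisMap σ * diagonal d * basisMap σ.symm = diagonal (d ∘ σ.symm) := by
  ext x y
  rw [mul_apply]
  simp only [mul_diagonal, basisMap_apply, diagonal_apply, Function.comp]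
  rw [Finset.sum_eq_single (σ.symm y)]
  · by_cases h : x = y <;> simp [h]
  · intro z _ hz
    simp [hz]
  · simp

theorem tensor_mul (A B : Fin n → Matrix (Fin 2) (Fin 2) ℝ) :
    tensor A * tensor B = tensor fun k => A k * B k := by
  ext x y
  simp only [mul_apply, tensor_apply, Fintype.prod_sum, Finset.prod_mul_distrib]

theorem tensor_one : tensor (fun _ : Fin n => 1) = 1 := by
  ext x y
  simp only [tensor_apply, one_apply, Finset.prod_ite_zero, Finset.prod_const_one]
  exact if_congr (by simp [funext_iff]) rfl rfl

theorem tensor_transpose (A : Fin n → Matrix (Fin 2) (Fin 2) ℝ) :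
    (tensor A)ᵀ = tensor fun k => (A k)ᵀ := rfl

theorem onQubit_mul (k : Fin n) (A B : Matrix (Fin 2) (Fin 2) ℝ) :
    onQubit k A * onQubit k B = onQubit k (A * B) := by
  simp only [onQubit, tensor_mul]
  congr 1
  ext1 l
  by_cases h : l = k
  · subst h; simp
  · simp [h]

theorem onQubit_one (k : Fin n) : onQubit k 1 = 1 := by
  rw [onQubit, ← tensor_one]
  congr 1
  exact Function.update_eq_self k _

theorem onQubit_transpose (k : Fin n) (A : Matrix (Fin 2) (Fin 2) ℝ) :
    (onQubit k A)ᵀ = onQubit k Aᵀ := by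
  simp only [onQubit, tensor_transpose]
  congr 1
  ext1 l
  by_cases h : l = k
  · subst h; simp
  · simp [h]

/-- Written as a sum over the new bit `b`, so that a product with any matrix collapses to two terms.
-/
theorem onQubit_apply (k : Fin n) (A : Matrix (Fin 2) (Fin 2) ℝ) (x y : Basis n) :
    onQubit k A x y = ∑ b, if y = update x k b then A (x k) b else 0 := by
  rw [Finset.sum_eq_single (y k)]
  · rw [onQubit, tensor_apply, ← Finset.mul_prod_erase _ _ (Finset.mem_univ k)]
    have h : ∀ l ∈ Finset.univ.erase k,
        update (fun _ => (1 : Matrix (Fin 2) (Fin 2) ℝ)) k A l (x l) (y l) =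
          if x l = y l then 1 else 0 := by
      intro l hl
      rw [update_of_ne (Finset.ne_of_mem_erase hl), one_apply]
    rw [Finset.prod_congr rfl h, Finset.prod_ite_zero, update_self]
    simp only [Finset.prod_const_one, mul_ite, mul_one, mul_zero]
    refine if_congr ⟨fun h => ?_, fun h l hl => ?_⟩ rfl rfl
    · ext1 l
      by_cases hl : l = k
      · subst hl; simp
      · rw [update_of_ne hl]; exact (h l (by simp [hl])).symm
    · rw [h, update_of_ne (Finset.ne_of_mem_erase hl)]
  · intro b _ hb
    rw [if_neg]
    intro h
    exact hb (by rw [h, update_self])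
  · simp

theorem onQubit_mul_apply (k : Fin n) (A : Matrix (Fin 2) (Fin 2) ℝ) (M : Gate n)
    (x y : Basis n) :
    (onQubit k A * M) x y = ∑ b, A (x k) b * M (update x k b) y := by
  simp only [mul_apply, onQubit_apply, Finset.sum_mul]
  rw [Finset.sum_comm]
  simp

theorem hadamard_transpose : hadamardᵀ = hadamard := by
  ext a b
  fin_cases a <;> fin_cases b <;> simp [hadamard]

theorem hadamard_mul_self : hadamard * hadamard = 1 := by
  ext a b
  fin_cases a <;> fin_cases b <;> simp [hadamard, mul_apply, Fin.sum_univ_two, ← mul_inv] <;>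
    norm_num

theorem onQubit_hadamard_mul_self (k : Fin n) : onQubit k hadamard * onQubit k hadamard = 1 := by
  rw [onQubit_mul, hadamard_mul_self, onQubit_one]

theorem onQubit_hadamard_transpose (k : Fin n) : (onQubit k hadamard)ᵀ = onQubit k hadamard := by
  rw [onQubit_transpose, hadamard_transpose]

/-- Conjugating a phase that is controlled by qubit `k` with a Hadamard gate on qubit `k` gives a
negation of qubit `k`, under the same control by the other qubits. -/
theorem hadamard_conj_controlled (k : Fin n) (g : Basis n → Fin 2)
    (hg : ∀ y b, g (update y k b) = g y) :
    onQubit k hadamard * diagonal (fun y => if y k * g y = 1 then -1 else 1) *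
      onQubit k hadamard = basisMap fun y => update y k (y k + g y) := by
  ext x y
  rw [mul_assoc, onQubit_mul_apply, basisMap_apply]
  simp only [diagonal_mul, onQubit_apply, update_idem, update_self, hg]
  by_cases h : y = update x k (y k)
  · have hg' : g y = g x := by rw [h, hg]
    have h1 : ∀ b, y = update x k b ↔ b = y k := by
      intro b
      refine ⟨fun e => by rw [e, update_self], ?_⟩
      rintro rfl
      exact h
    have h2 : x = update y k (y k + g x) ↔ x k = y k + g x := by
      refine ⟨fun e => by simpa using congrFun e k, fun e => ?_⟩
      rw [← e, h]
      simp
    simp only [h1, hg', h2]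
    generalize g x = c
    generalize x k = a
    generalize y k = b
    have hs : (√2)⁻¹ * (√2)⁻¹ = (1 / 2 : ℝ) := by rw [← mul_inv]; norm_num
    fin_cases a <;> fin_cases b <;> fin_cases c <;>
      simp [hadamard, Fin.sum_univ_two, hs] <;> norm_num
  · have h1 : ∀ b, ¬ y = update x k b := by
      intro b e
      exact h (by rw [e, update_self])
    have h2 : ¬ x = update y k (y k + g y) := by
      intro e
      apply h
      rw [e]
      simp
    simp [h1, h2]

/-- The gate that permutes the qubits: `|y⟩ ↦ |y ∘ σ⟩`. -/
def relabel (σ : Equiv.Perm (Fin n)) : Gate n := basisMap fun y k => y (σ k)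

theorem relabel_eq (σ : Equiv.Perm (Fin n)) :
    relabel σ = basisMap (σ.symm.arrowCongr (Equiv.refl (Fin 2))) := rfl

/-- The order reverses because a relabelling acts on bit strings by precomposition. -/
theorem relabel_mul (σ τ : Equiv.Perm (Fin n)) : relabel σ * relabel τ = relabel (τ * σ) := by
  simp only [relabel, basisMap_mul]
  rfl

theorem relabel_one : relabel (1 : Equiv.Perm (Fin n)) = 1 := basisMap_id

theorem relabel_transpose (σ : Equiv.Perm (Fin n)) : (relabel σ)ᵀ = relabel σ⁻¹ := by
  rw [relabel_eq, basisMap_perm_transpose]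
  rfl

theorem relabel_mul_transpose (σ : Equiv.Perm (Fin n)) : relabel σ * (relabel σ)ᵀ = 1 := by
  rw [relabel_transpose, relabel_mul, inv_mul_cancel, relabel_one]

theorem relabel_transpose_mul (σ : Equiv.Perm (Fin n)) : (relabel σ)ᵀ * relabel σ = 1 := by
  rw [relabel_transpose, relabel_mul, mul_inv_cancel, relabel_one]

theorem relabel_mul_tensor (σ : Equiv.Perm (Fin n)) (A : Fin n → Matrix (Fin 2) (Fin 2) ℝ) :
    relabel σ * tensor A = tensor (fun k => A (σ k)) * relabel σ := by
  ext x y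
  simp only [mul_apply, relabel, basisMap_apply, tensor_apply, ite_mul, one_mul, zero_mul,
    mul_ite, mul_one, mul_zero, Finset.sum_ite_eq', Finset.mem_univ, if_true]
  rw [Finset.sum_eq_single fun k => x (σ.symm k)]
  · rw [if_pos (by ext1; simp), ← Equiv.prod_comp σ]
    simp
  · intro z _ hz
    rw [if_neg]
    rintro rfl
    exact hz (by ext1; simp)
  · simp

theorem relabel_mul_onQubit (σ : Equiv.Perm (Fin n)) (k : Fin n)
    (A : Matrix (Fin 2) (Fin 2) ℝ) :
    relabel σ * onQubit (σ k) A = onQubit k A * relabel σ := by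
  rw [onQubit, relabel_mul_tensor, onQubit]
  congr 2
  ext1 l
  by_cases h : l = k
  · subst h; simp
  · simp [h]

theorem relabel_conj_basisMap (σ : Equiv.Perm (Fin n)) (f : Basis n → Basis n) :
    relabel σ * basisMap f * (relabel σ)ᵀ =
      basisMap fun y k => f (fun l => y (σ.symm l)) (σ k) := by
  rw [relabel_transpose]
  simp only [relabel, basisMap_mul]
  rfl

/-- A property of basis vectors that survives the change of any one bit holds everywhere if it
holds somewhere. -/
theorem basis_induction {p : Basis n → Prop} (x : Basis n) (hx : p x)
    (step : ∀ y k, p y → p (update y k (y k + 1))) (y : Basis n) : p y := by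
  have key : ∀ s : Finset (Fin n), p (s.piecewise y x) := by
    intro s
    induction s using Finset.induction_on with
    | empty => simpa using hx
    | insert k s hk ih =>
      rw [Finset.piecewise_insert]
      by_cases h : y k = s.piecewise y x k
      · rw [h, update_eq_self]; exact ih
      · have : y k = s.piecewise y x k + 1 := by
          revert h
          generalize y k = a
          generalize s.piecewise y x k = b
          revert a b
          decide
        rw [this]
        exact step _ k ih
  simpa using key Finset.univ

/-- The controlled negation with control `s` and target `t`. -/
def cnot (t s : Fin n) : Gate n := basisMap fun y => update y t (y t + y s)

theorem cnot_eq_hadamard_conj {t s : Fin n} (h : s ≠ t) :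
    onQubit t hadamard * diagonal (fun y => if y t * y s = 1 then -1 else 1) *
      onQubit t hadamard = cnot t s :=
  hadamard_conj_controlled t (fun y => y s) fun y b => by simp [h]

theorem relabel_conj_cnot (σ : Equiv.Perm (Fin n)) (t s : Fin n) :
    relabel σ * cnot (σ t) (σ s) * (relabel σ)ᵀ = cnot t s := by
  rw [cnot, relabel_conj_basisMap, cnot]
  congr 1
  ext1 y
  ext1 k
  by_cases h : k = t
  · subst h; simp
  · simp [h]

theorem mul_onQubit_apply (k : Fin n) (A : Matrix (Fin 2) (Fin 2) ℝ) (M : Gate n)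
    (x y : Basis n) :
    (M * onQubit k A) x y = ∑ b, M x (update y k b) * A b (y k) := by
  rw [← transpose_apply (M * onQubit k A), transpose_mul, onQubit_transpose, onQubit_mul_apply]
  simp only [transpose_apply, mul_comm]

/-- The hypothesis `hf` says that `f` neither reads nor changes bit `k`. -/
theorem onQubit_commute_basisMap (k : Fin n) (A : Matrix (Fin 2) (Fin 2) ℝ)
    {f : Basis n → Basis n} (hf : ∀ y b, f (update y k b) = update (f y) k b) :
    onQubit k A * basisMap f = basisMap f * onQubit k A := by
  ext x y
  have hk : f y k = y k := by simpa using congrFun (hf y (y k)) k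
  rw [onQubit_mul_apply, mul_onQubit_apply]
  simp only [basisMap_apply, hf, mul_ite, ite_mul, mul_one, one_mul, mul_zero, zero_mul]
  by_cases h : x = update (f y) k (x k)
  · have h1 : ∀ b, update x k b = f y ↔ b = y k := by
      intro b
      refine ⟨fun e => by rw [← hk, ← e, update_self], ?_⟩
      rintro rfl
      rw [h, update_idem, ← hk, update_eq_self]
    have h2 : ∀ b, x = update (f y) k b ↔ b = x k := by
      intro b
      refine ⟨fun e => by rw [e, update_self], ?_⟩
      rintro rfl
      exact h
    simp [h1, h2]
  · have h1 : ∀ b, ¬ update x k b = f y := by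
      intro b e
      apply h
      rw [← e]
      simp
    have h2 : ∀ b, ¬ x = update (f y) k b := by
      intro b e
      exact h (by rw [e]; simp)
    simp [h1, h2]

theorem onQubit_commute_cnot {k t s : Fin n} (A : Matrix (Fin 2) (Fin 2) ℝ) (ht : t ≠ k)
    (hs : s ≠ k) : onQubit k A * cnot t s = cnot t s * onQubit k A := by
  refine onQubit_commute_basisMap k A fun y b => ?_
  rw [update_of_ne ht, update_of_ne hs, update_comm ht]

/-- The XOR swap: three additions modulo 2 exchange two bits. -/
theorem cnot_mul_cnot_mul_cnot {t s : Fin n} (h : s ≠ t) :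
    cnot t s * cnot s t * cnot t s = relabel (Equiv.swap t s) := by
  simp only [cnot, basisMap_mul, relabel]
  congr 1
  ext1 y
  ext1 k
  simp only [Function.comp]
  rcases eq_or_ne k t with rfl | hk
  · simp only [update_self, update_of_ne h, update_of_ne h.symm, Equiv.swap_apply_left]
    generalize y k = a
    generalize y s = b
    revert a b
    decide
  rcases eq_or_ne k s with rfl | hk'
  · simp only [update_self, update_of_ne h, update_of_ne h.symm, Equiv.swap_apply_right]
    generalize y k = a
    generalize y t = b
    revert a b
    decide
  · simp [hk, hk', Equiv.swap_apply_of_ne_of_ne]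

end Calculus

/-! ### Powers of `V n` and the gates reachable by words -/

section Words

variable {n : ℕ}

theorem onQubit_commute {k l : Fin n} (h : k ≠ l) (A B : Matrix (Fin 2) (Fin 2) ℝ) :
    onQubit k A * onQubit l B = onQubit l B * onQubit k A := by
  simp only [onQubit, tensor_mul]
  congr 1
  ext1 m
  rcases eq_or_ne m k with rfl | hk
  · simp [h]
  · simp [hk]

theorem qubitFlip_eq_diagonal (k : Fin n) :
    (qubitFlip k : Gate n) = diagonal fun y => if y k = 1 then -1 else 1 := by
  ext x y
  rw [qubitFlip, onQubit_apply, diagonal_apply]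
  by_cases h : x = y
  · subst h
    have h1 : ∀ b, x = update x k b ↔ b = x k := by
      intro b
      rw [eq_comm, update_eq_self_iff]
    simp only [h1, if_true, Finset.sum_ite_eq', Finset.mem_univ]
    generalize x k = a
    fin_cases a <;> simp [pauliZ]
  · rw [if_neg h]
    refine Finset.sum_eq_zero fun b _ => ?_
    split_ifs with e
    · have hb : x k ≠ b := by
        rintro rfl
        exact h (by simpa using e.symm)
      revert hb
      generalize x k = a
      fin_cases a <;> fin_cases b <;> simp [pauliZ]
    · rfl

/-- The bit flip `X` on one qubit. -/
def bitFlip (k : Fin n) : Equiv.Perm (Basis n) :=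
  Involutive.toPerm (fun y => update y k (y k + 1)) fun y => by
    have : ∀ a : Fin 2, a + 1 + 1 = a := by decide
    simp [this]

theorem bitFlip_apply (k : Fin n) (y : Basis n) : bitFlip k y = update y k (y k + 1) := rfl

theorem bitFlip_symm (k : Fin n) : (bitFlip k).symm = bitFlip k := rfl

theorem hadamard_conj_qubitFlip (k : Fin n) :
    onQubit k hadamard * qubitFlip k * onQubit k hadamard = basisMap (bitFlip k) := by
  rw [qubitFlip_eq_diagonal]
  have := hadamard_conj_controlled k (fun _ => 1) fun _ _ => rfl
  simp only [mul_one] at this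
  exact this

theorem hadamard_conj_phaseFlip (k : Fin n) (x : Basis n) (hx : x k = 1) :
    onQubit k hadamard * phaseFlip x * onQubit k hadamard =
      basisMap (Equiv.swap x (bitFlip k x)) := by
  -- The sign flip at `x` is a `Z` on qubit `k`, controlled by agreement with `x` on all other bits;
  -- `x k = 1` is the value that `Z` negates.
  have h := hadamard_conj_controlled k (fun y => if y = update x k (y k) then 1 else 0) fun y b => by
    simp only [update_self]
    refine if_congr ⟨fun e => ?_, fun e => ?_⟩ rfl rfl
    · simpa using congrArg (fun z => update z k (y k)) e
    · simpa using congrArg (fun z => update z k b) e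
  have hD : (phaseFlip x : Gate n) = diagonal fun y => if y k *
      (if y = update x k (y k) then 1 else 0) = 1 then -1 else 1 := by
    rw [phaseFlip]
    congr 1
    ext1 y
    refine if_congr ⟨?_, fun e => ?_⟩ rfl rfl
    · rintro rfl
      simp [hx]
    · have h2 : y = update x k (y k) := by
        by_contra h2
        simp [h2] at e
      rw [if_pos h2, mul_one] at e
      rw [h2, e, ← hx, update_eq_self]
  rw [hD, h]
  congr 1
  ext1 y
  have h0 : bitFlip k x = update x k 0 := by rw [bitFlip_apply, hx]; rfl
  by_cases h2 : y = update x k (y k)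
  · rw [if_pos h2]
    have h3 : y k = 0 ∨ y k = 1 := by
      generalize y k = a
      revert a
      decide
    rcases h3 with h3 | h3
    · rw [h3] at h2
      rw [h0, ← h2, Equiv.swap_apply_right, h3, h2, update_idem, zero_add, ← hx, update_eq_self]
    · rw [h3, ← hx, update_eq_self] at h2
      rw [h2, Equiv.swap_apply_left, hx, bitFlip_apply, hx]
  · rw [if_neg h2, add_zero, update_eq_self, Equiv.swap_apply_of_ne_of_ne]
    · rintro rfl
      simp at h2
    · intro e
      apply h2
      rw [e, h0]
      simp

theorem relabel_conj_onQubit (σ : Equiv.Perm (Fin n)) (k : Fin n)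
    (A : Matrix (Fin 2) (Fin 2) ℝ) :
    relabel σ * onQubit (σ k) A * (relabel σ)ᵀ = onQubit k A := by
  rw [relabel_mul_onQubit, mul_assoc, relabel_mul_transpose, mul_one]

theorem diagonal_sign_mem_orthogonalGroup {s : Basis n → ℝ} (hs : ∀ x, s x = 1 ∨ s x = -1) :
    (diagonal s : Gate n) ∈ orthogonalGroup (Basis n) ℝ := by
  rw [mem_orthogonalGroup_iff, diagonal_transpose,
    diagonal_mul_diagonal, ← diagonal_one]
  congr 1
  ext1 x
  rcases hs x with h | h <;> simp [h]

theorem phaseFlip_ne_qubitFlip (hn : 2 ≤ n) (i : Basis n) (j : Fin n) :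
    phaseFlip i ≠ (qubitFlip j : Gate n) := by
  rw [qubitFlip_eq_diagonal, phaseFlip, Ne, diagonal_eq_diagonal_iff]
  intro h
  have key : ∀ x : Basis n, x j = 1 → x = i := by
    intro x hx
    by_contra hxi
    have := h x
    rw [if_neg hxi, if_pos hx] at this
    norm_num at this
  have : Nontrivial (Fin n) := Fin.nontrivial_iff_two_le.2 hn
  obtain ⟨k, hk⟩ := exists_ne j
  have h1 := key (fun _ => 1) rfl
  have h2 := key (update (fun _ => 1) k 0) (by simp [hk.symm])
  simpa using congrFun (h1.trans h2.symm) k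

theorem finRotate_val (k : Fin n) : (finRotate n k).val = (k.val + 1) % n := by
  rw [finRotate_apply, Fin.val_add, Fin.val_one', Nat.add_mod_mod]

theorem finRotate_pow_val (m : ℕ) (k : Fin n) :
    ((finRotate n ^ m) k).val = (k.val + m) % n := by
  induction m with
  | zero => simp [Nat.mod_eq_of_lt]
  | succ m ih =>
    rw [pow_succ', Equiv.Perm.mul_apply, finRotate_val, ih, Nat.mod_add_mod, add_assoc]

theorem finRotate_eq {l k : Fin n} (h : l.val + 1 = k.val) : finRotate n l = k := by
  ext
  rw [finRotate_val, h, Nat.mod_eq_of_lt k.isLt]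

variable [NeZero n]

theorem finRotate_last {l : Fin n} (h : l.val + 1 = n) : finRotate n l = 0 := by
  ext
  rw [finRotate_val, h]
  simp

theorem V_eq : V n = relabel (finRotate n) * onQubit 0 hadamard := rfl

theorem V_transpose : (V n)ᵀ = onQubit 0 hadamard * (relabel (finRotate n))ᵀ := by
  rw [V_eq, transpose_mul, onQubit_hadamard_transpose]

theorem V_mul_transpose : V n * (V n)ᵀ = 1 := by
  rw [V_transpose, V_eq, mul_assoc, ← mul_assoc (onQubit 0 hadamard), onQubit_hadamard_mul_self,
    one_mul, relabel_mul_transpose]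

theorem V_pow_of_le (m : ℕ) (hm : m ≤ n) :
    V n ^ m = relabel (finRotate n ^ m) *
      tensor fun k => if k.val < m then hadamard else 1 := by
  induction m with
  | zero => simp [relabel_one, tensor_one]
  | succ m ih =>
    -- Pulled through the shift by `m`, the next Hadamard gate lands on qubit `m`.
    have h0 : (finRotate n ^ m) 0 = ⟨m, hm⟩ := by
      ext
      rw [finRotate_pow_val]
      simp [Nat.mod_eq_of_lt hm]
    rw [pow_succ', ih (by omega), V_eq, mul_assoc, ← mul_assoc (onQubit 0 hadamard),
      ← relabel_mul_onQubit, h0, mul_assoc, ← mul_assoc, relabel_mul, ← pow_succ, onQubit, tensor_mul]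
    congr 2
    ext1 k
    rcases lt_trichotomy k.val m with h | h | h
    · rw [update_of_ne (by rintro rfl; simp at h), one_mul, if_pos h, if_pos (by omega)]
    · obtain rfl : k = ⟨m, hm⟩ := Fin.ext h
      simp
    · rw [update_of_ne (by rintro rfl; simp at h), one_mul, if_neg (by omega), if_neg (by omega)]

theorem V_pow_self : V n ^ n = tensor fun _ => hadamard := by
  rw [V_pow_of_le n le_rfl]
  have : finRotate n ^ n = 1 := by
    ext k
    rw [finRotate_pow_val]
    simp [Nat.mod_eq_of_lt]
  simp [this, relabel_one]

/-- Words contain no inverses; finite order supplies this one. -/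
theorem V_transpose_eq_pow : (V n)ᵀ = V n ^ (2 * n - 1) := by
  have h1 : V n ^ (2 * n) = 1 := by
    rw [two_mul, pow_add, V_pow_self, tensor_mul]
    simp only [hadamard_mul_self, tensor_one]
  have h2 : V n ^ (2 * n) = V n * V n ^ (2 * n - 1) := by
    rw [← pow_succ']
    congr 1
    have := NeZero.pos n
    omega
  rw [← one_mul (V n ^ _), ← mul_eq_one_comm.1 V_mul_transpose, mul_assoc, ← h2, h1, mul_one]

/-! ### Gates that are words in the alphabet -/

variable {i : Basis n} {j : Fin n}

theorem V_mem : V n ∈ words (alphabet n i j) :=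
  Submonoid.subset_closure (by simp [alphabet])

theorem V_transpose_mem : (V n)ᵀ ∈ words (alphabet n i j) := by
  rw [V_transpose_eq_pow]
  exact pow_mem V_mem _

theorem V_conj_mem {M : Gate n} (hM : M ∈ words (alphabet n i j)) :
    V n * M * (V n)ᵀ ∈ words (alphabet n i j) :=
  mul_mem (mul_mem V_mem hM) V_transpose_mem

theorem V_transpose_conj_mem {M : Gate n} (hM : M ∈ words (alphabet n i j)) :
    (V n)ᵀ * M * V n ∈ words (alphabet n i j) :=
  mul_mem (mul_mem V_transpose_mem hM) V_mem

/-- Conjugation by `V` shifts a gate that commutes with the Hadamard gate on qubit `0`. -/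
theorem relabel_conj_mem {M : Gate n} (hM : M ∈ words (alphabet n i j))
    (h : onQubit 0 hadamard * M = M * onQubit 0 hadamard) :
    relabel (finRotate n) * M * (relabel (finRotate n))ᵀ ∈ words (alphabet n i j) := by
  convert! V_conj_mem hM using 1
  rw [V_transpose, V_eq, mul_assoc (relabel _) (onQubit 0 hadamard), h]
  simp only [mul_assoc]
  rw [← mul_assoc (onQubit 0 hadamard) (onQubit 0 hadamard), onQubit_hadamard_mul_self, one_mul]

/-- Each conjugation by `V n` lowers the qubit by one. The descent stops at qubit `0`, where `A`
need not commute with the Hadamard gate. -/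
theorem onQubit_mem_of_le {A : Matrix (Fin 2) (Fin 2) ℝ} {k : Fin n}
    (hk : onQubit k A ∈ words (alphabet n i j)) (l : Fin n) (hl : l ≤ k) :
    onQubit l A ∈ words (alphabet n i j) := by
  obtain ⟨d, hd⟩ := Nat.exists_eq_add_of_le (Fin.le_def.1 hl)
  induction d generalizing l with
  | zero =>
    obtain rfl : k = l := Fin.ext hd
    exact hk
  | succ d ih =>
    have hlt : l.val + 1 < n := by have := k.isLt; omega
    have h := ih ⟨l.val + 1, hlt⟩ (Fin.le_def.2 (by simp only; omega)) (by simp only; omega)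
    have hσ : finRotate n l = ⟨l.val + 1, hlt⟩ := finRotate_eq rfl
    rw [← relabel_conj_onQubit (finRotate n) l A, hσ]
    exact relabel_conj_mem h (onQubit_commute (by rw [Ne, Fin.ext_iff]; simp) _ _)

theorem bitFlip_mem (k : Fin n) : basisMap (bitFlip k) ∈ words (alphabet n i j) := by
  have hj : onQubit j pauliZ ∈ words (alphabet n i j) :=
    Submonoid.subset_closure (by simp [alphabet, qubitFlip])
  have h0 := V_conj_mem (onQubit_mem_of_le hj 0 (Fin.zero_le _))
  have hpos := NeZero.pos n
  let l : Fin n := ⟨n - 1, by omega⟩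
  have hσ : finRotate n l = 0 := finRotate_last (by simp only [l]; omega)
  -- Passing through qubit `0` turns `Z` into `H Z H = X` on the last qubit.
  have h1 : V n * onQubit 0 pauliZ * (V n)ᵀ = onQubit l (hadamard * pauliZ * hadamard) := by
    rw [← relabel_conj_onQubit (finRotate n) l, hσ, ← onQubit_mul, ← onQubit_mul, V_transpose, V_eq]
    simp only [mul_assoc]
  rw [h1] at h0
  rw [← hadamard_conj_qubitFlip, qubitFlip, onQubit_mul, onQubit_mul]
  exact onQubit_mem_of_le h0 k (Fin.le_def.2 (by simp only [l]; omega))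

theorem phaseFlip_mem (x : Basis n) : phaseFlip x ∈ words (alphabet n i j) := by
  refine basis_induction (p := fun x => phaseFlip x ∈ words (alphabet n i j)) i
    (Submonoid.subset_closure (by simp [alphabet])) (fun y k hy => ?_) x
  have := mul_mem (mul_mem (bitFlip_mem (i := i) (j := j) k) hy) (bitFlip_mem k)
  convert! this using 1
  rw [phaseFlip, phaseFlip]
  nth_rw 2 [← bitFlip_symm k]
  rw [basisMap_mul_diagonal_mul]
  congr 1
  ext1 z
  exact if_congr (by rw [Equiv.symm_apply_eq]; rfl) rfl rfl

theorem diagonal_sign_mem (s : Basis n → ℝ) (hs : ∀ x, s x = 1 ∨ s x = -1) :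
    diagonal s ∈ words (alphabet n i j) := by
  have key : ∀ t : Finset (Basis n),
      (diagonal fun x => if x ∈ t then -1 else 1 : Gate n) ∈ words (alphabet n i j) := by
    intro t
    induction t using Finset.induction_on with
    | empty => simp
    | insert a t ha ih =>
      convert! mul_mem (phaseFlip_mem (i := i) (j := j) a) ih using 1
      rw [phaseFlip, diagonal_mul_diagonal]
      congr 1
      ext1 x
      by_cases hx : x = a
      · subst hx; simp [ha]
      · simp [hx]
  convert! key (Finset.univ.filter fun x => s x = -1) using 2
  ext1 x
  rcases hs x with h | h <;> norm_num [h]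

/-- The diagonal is shifted beforehand, so that the shifts inside `(V n)ᵀ` and `V n` cancel and only
the Hadamard conjugation on qubit `0` remains. -/
theorem cnot_zero_mem {s : Fin n} (hs : s ≠ 0) : cnot 0 s ∈ words (alphabet n i j) := by
  let d : Basis n → ℝ := fun y => if y 0 * y s = 1 then -1 else 1
  let σ := (finRotate n).symm.arrowCongr (Equiv.refl (Fin 2))
  have hd : (diagonal (d ∘ σ.symm) : Gate n) ∈ words (alphabet n i j) :=
    diagonal_sign_mem _ fun x => by simp only [d, Function.comp]; split_ifs <;> simp
  convert! V_transpose_conj_mem hd using 1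
  rw [← basisMap_mul_diagonal_mul, ← basisMap_perm_transpose, ← relabel_eq, V_transpose, V_eq,
    ← cnot_eq_hadamard_conj hs]
  simp only [mul_assoc]
  rw [← mul_assoc (relabel _)ᵀ (relabel _) (onQubit 0 hadamard), relabel_transpose_mul, one_mul,
    ← mul_assoc (relabel _)ᵀ (relabel _), relabel_transpose_mul, one_mul]

theorem cnot_last_mem {t s : Fin n} (ht : t.val + 1 = n) (hs : s ≠ t) :
    cnot t s ∈ words (alphabet n i j) := by
  have hσ : finRotate n t = 0 := finRotate_last ht
  have hd : (diagonal fun y => if y 0 * y (finRotate n s) = 1 then -1 else 1 : Gate n) ∈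
      words (alphabet n i j) :=
    diagonal_sign_mem _ fun x => by split_ifs <;> simp
  convert! V_conj_mem hd using 1
  rw [← relabel_conj_cnot (finRotate n), hσ,
    ← cnot_eq_hadamard_conj (by rw [← hσ]; exact (finRotate n).injective.ne hs), V_transpose, V_eq]
  simp only [mul_assoc]

/-- Descent from target `n - 1` by conjugation with `V n`: neither qubit is `0` before a step. -/
theorem cnot_mem_of_lt {t s : Fin n} (h : s < t) : cnot t s ∈ words (alphabet n i j) := by
  obtain ⟨d, hd⟩ := Nat.exists_eq_add_of_le (Nat.succ_le_of_lt t.isLt)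
  induction d generalizing t s with
  | zero => exact cnot_last_mem (by omega) h.ne
  | succ d ih =>
    rw [Fin.lt_def] at h
    have h1 : finRotate n t = ⟨t.val + 1, by omega⟩ := finRotate_eq rfl
    have h2 : finRotate n s = ⟨s.val + 1, by omega⟩ := finRotate_eq rfl
    rw [← relabel_conj_cnot (finRotate n), h1, h2]
    refine relabel_conj_mem (ih (Fin.lt_def.2 (by simp only; omega)) (by simp only; omega))
      (onQubit_commute_cnot _ ?_ ?_) <;>
    · rw [Ne, Fin.ext_iff]; simp

/-- Ascent from target `0` by conjugation with `(V n)ᵀ`: neither qubit is `0` after a step, so the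
Hadamard gates cancel. -/
theorem cnot_mem_of_gt {t s : Fin n} (h : t < s) : cnot t s ∈ words (alphabet n i j) := by
  obtain ⟨d, hd⟩ : ∃ d, t.val = d := ⟨_, rfl⟩
  induction d generalizing t s with
  | zero =>
    obtain rfl : t = 0 := Fin.ext (by simpa using hd)
    exact cnot_zero_mem h.ne'
  | succ d ih =>
    rw [Fin.lt_def] at h
    have ht0 : t ≠ 0 := by rw [Ne, Fin.ext_iff]; simp [hd]
    have hs0 : s ≠ 0 := by rintro rfl; simp at h
    let t' : Fin n := ⟨t.val - 1, by omega⟩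
    let s' : Fin n := ⟨s.val - 1, by have := s.isLt; omega⟩
    have h1 : finRotate n t' = t := finRotate_eq (by simp only [t']; omega)
    have h2 : finRotate n s' = s := finRotate_eq (by simp only [s']; omega)
    have hm : cnot t' s' ∈ words (alphabet n i j) :=
      ih (Fin.lt_def.2 (by simp only [t', s']; omega)) (by simp only [t']; omega)
    convert! V_transpose_conj_mem hm using 1
    rw [← relabel_conj_cnot (finRotate n) t' s', h1, h2, V_transpose, V_eq]
    simp only [mul_assoc]
    rw [← mul_assoc (relabel _)ᵀ (relabel _), relabel_transpose_mul, one_mul,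
      ← mul_assoc (relabel _)ᵀ (relabel _), relabel_transpose_mul, one_mul,
      ← onQubit_commute_cnot _ ht0 hs0, ← mul_assoc, onQubit_hadamard_mul_self, one_mul]

theorem relabel_mem (σ : Equiv.Perm (Fin n)) : relabel σ ∈ words (alphabet n i j) := by
  induction σ using Equiv.Perm.swap_induction_on with
  | one => rw [relabel_one]; exact one_mem _
  | swap_mul f x y hxy ih =>
    rw [← relabel_mul]
    refine mul_mem ih ?_
    rw [← cnot_mul_cnot_mul_cnot hxy.symm]
    have : ∀ t s : Fin n, t ≠ s → cnot t s ∈ words (alphabet n i j) := fun t s h =>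
      (lt_or_gt_of_ne h).elim cnot_mem_of_gt cnot_mem_of_lt
    exact mul_mem (mul_mem (this _ _ hxy) (this _ _ hxy.symm)) (this _ _ hxy)

theorem hadamard_mem (k : Fin n) : onQubit k hadamard ∈ words (alphabet n i j) := by
  have h0 : onQubit 0 hadamard ∈ words (alphabet n i j) := by
    -- The inverse shift is now a word, and it strips the shift from `V n`.
    have := mul_mem (relabel_mem (i := i) (j := j) (finRotate n)⁻¹) V_mem
    rwa [V_eq, ← mul_assoc, ← relabel_transpose, relabel_transpose_mul, one_mul] at this
  have hσ : Equiv.swap k 0 k = 0 := Equiv.swap_apply_left _ _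
  rw [← relabel_conj_onQubit (Equiv.swap k 0), hσ, relabel_transpose]
  exact mul_mem (mul_mem (relabel_mem _) h0) (relabel_mem _)

theorem basisMap_perm_mem (σ : Equiv.Perm (Basis n)) :
    basisMap σ ∈ words (alphabet n i j) := by
  let C : Submonoid (Equiv.Perm (Basis n)) :=
    { carrier := {σ | basisMap σ ∈ words (alphabet n i j)}
      one_mem' := by
        change basisMap id ∈ words (alphabet n i j)
        rw [basisMap_id]
        exact one_mem _
      mul_mem' := by
        intro σ τ hσ hτ
        change basisMap (σ ∘ τ) ∈ words (alphabet n i j)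
        rw [← basisMap_mul]
        exact mul_mem hσ hτ }
  have hstep : ∀ (x : Basis n) (k : Fin n), Equiv.swap x (bitFlip k x) ∈ C := by
    have h1 : ∀ (x : Basis n) (k : Fin n), x k = 1 → Equiv.swap x (bitFlip k x) ∈ C := by
      intro x k hx
      change basisMap (Equiv.swap x (bitFlip k x)) ∈ words (alphabet n i j)
      rw [← hadamard_conj_phaseFlip k x hx]
      exact mul_mem (mul_mem (hadamard_mem k) (phaseFlip_mem x)) (hadamard_mem k)
    intro x k
    by_cases hx : x k = 1
    · exact h1 x k hx
    · have h2 := h1 (bitFlip k x) k (by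
        rw [bitFlip_apply, update_self]
        revert hx
        generalize x k = a
        revert a
        decide)
      have h3 : bitFlip k (bitFlip k x) = x := (bitFlip k).symm_apply_apply x
      rwa [h3, Equiv.swap_comm] at h2
  -- The hypercube is connected, and transpositions along a path compose to the transposition of its
  -- ends.
  have hswap : ∀ x y : Basis n, Equiv.swap x y ∈ C := fun x =>
    basis_induction x (by rw [Equiv.swap_self]; exact one_mem C) fun y k hy =>
      SubmonoidClass.swap_mem_trans C hy (hstep y k)
  suffices σ ∈ C from this
  induction σ using Equiv.Perm.swap_induction_on with
  | one => exact one_mem C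
  | swap_mul f x y _ ih => exact mul_mem (hswap x y) ih

theorem permMatrix_mem (σ : Equiv.Perm (Basis n)) :
    Equiv.Perm.permMatrix ℝ σ ∈ words (alphabet n i j) := by
  rw [permMatrix_eq_basisMap]
  exact basisMap_perm_mem _

theorem toffoli_mem {a b c : Fin n} (hac : a ≠ c) (hbc : b ≠ c) :
    toffoli a b c ∈ words (alphabet n i j) := by
  have hinv : Involutive fun y : Basis n => update y c (y c + y a * y b) := by
    intro y
    have h2 : ∀ u v : Fin 2, u + v + v = u := by decide
    simp [hac, hbc, h2]
  exact basisMap_perm_mem hinv.toPerm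

theorem words_hadamardToffoli_le :
    words (hadamardToffoli n) ≤ words (alphabet n i j) := by
  refine Submonoid.closure_le.2 ?_
  rintro M (⟨k, rfl⟩ | ⟨a, b, c, -, hac, hbc, rfl⟩)
  · exact hadamard_mem k
  · exact toffoli_mem hac hbc

theorem transpose_mem_words {M : Gate n} (hM : M ∈ words (alphabet n i j)) :
    Mᵀ ∈ words (alphabet n i j) := by
  induction hM using Submonoid.closure_induction with
  | mem M hM =>
    rcases hM with rfl | rfl | rfl
    · exact V_transpose_mem
    · rw [phaseFlip, diagonal_transpose]
      exact phaseFlip_mem i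
    · rw [qubitFlip_eq_diagonal, diagonal_transpose, ← qubitFlip_eq_diagonal]
      exact Submonoid.subset_closure (by simp [alphabet])
  | one => rw [transpose_one]; exact one_mem _
  | mul M N _ _ hM hN => rw [transpose_mul]; exact mul_mem hN hM

theorem alphabet_subset_orthogonalGroup :
    alphabet n i j ⊆ (orthogonalGroup (Basis n) ℝ : Set (Gate n)) := by
  rintro M (rfl | rfl | rfl)
  · rw [SetLike.mem_coe, mem_orthogonalGroup_iff]
    exact V_mul_transpose
  · exact diagonal_sign_mem_orthogonalGroup fun x => by split_ifs <;> simp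
  · rw [qubitFlip_eq_diagonal]
    exact diagonal_sign_mem_orthogonalGroup fun x => by split_ifs <;> simp

theorem words_le_orthogonalGroup :
    words (alphabet n i j) ≤ orthogonalGroup (Basis n) ℝ :=
  Submonoid.closure_le.2 alphabet_subset_orthogonalGroup

theorem V_ne_diagonal (hn : 2 ≤ n) (d : Basis n → ℝ) : V n ≠ diagonal d := by
  intro h
  have h1 : onQubit 0 hadamard = (relabel (finRotate n))ᵀ * diagonal d := by
    rw [← h, V_eq, ← mul_assoc, relabel_transpose_mul, one_mul]
  -- At row `|10…0⟩`, column `|0…0⟩` the Hadamard gate has a nonzero entry, whereas a shift never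
  -- maps one of these basis vectors to the other.
  have h2 := congrFun (congrFun h1 (update 0 0 1)) 0
  rw [mul_diagonal, transpose_apply, relabel, basisMap_apply, if_neg, zero_mul, onQubit_apply] at h2
  · simp [hadamard] at h2
  · intro e
    have hpos := NeZero.pos n
    let l : Fin n := ⟨n - 1, by omega⟩
    have hσ : finRotate n l = 0 := finRotate_last (by simp only [l]; omega)
    simpa [hσ] using congrFun e l

theorem alphabet_ncard (hn : 2 ≤ n) : (alphabet n i j).ncard = 3 := by
  refine Set.ncard_eq_three.2 ⟨_, _, _, ?_, ?_, ?_, rfl⟩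
  · exact V_ne_diagonal hn _
  · rw [qubitFlip_eq_diagonal]
    exact V_ne_diagonal hn _
  · exact phaseFlip_ne_qubitFlip hn i j

end Words

/-! ### Hyperplane reflections and irrational angles -/

section Reflections

variable {ι : Type*} [Fintype ι] [DecidableEq ι]

/-- The reflection in the hyperplane orthogonal to `w` (the identity if `w = 0`). -/
def hyperReflection (w : ι → ℝ) : Matrix ι ι ℝ := 1 - (2 / (w ⬝ᵥ w)) • vecMulVec w w

theorem hyperReflection_mulVec (w x : ι → ℝ) :
    hyperReflection w *ᵥ x = x - (2 / (w ⬝ᵥ w) * (w ⬝ᵥ x)) • w := by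
  rw [hyperReflection, sub_mulVec, one_mulVec, smul_mulVec, vecMulVec_mulVec, op_smul_eq_smul,
    smul_smul]

theorem hyperReflection_transpose (w : ι → ℝ) : (hyperReflection w)ᵀ = hyperReflection w := by
  simp [hyperReflection, transpose_vecMulVec]

theorem hyperReflection_mul_self (w : ι → ℝ) : hyperReflection w * hyperReflection w = 1 := by
  rw [hyperReflection, sub_mul, Matrix.one_mul, mul_sub, Matrix.mul_one,
    smul_mul_smul_comm,
    vecMulVec_mul_vecMulVec, vecMulVec_smul, smul_smul]
  by_cases h : w ⬝ᵥ w = 0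
  · simp [h]
  · have h2 : 2 / (w ⬝ᵥ w) * (2 / (w ⬝ᵥ w)) * (w ⬝ᵥ w) = 2 / (w ⬝ᵥ w) + 2 / (w ⬝ᵥ w) := by
      field_simp; norm_num
    rw [h2, add_smul]
    abel

theorem hyperReflection_smul {r : ℝ} (hr : r ≠ 0) (w : ι → ℝ) :
    hyperReflection (r • w) = hyperReflection w := by
  simp only [hyperReflection, smul_dotProduct, dotProduct_smul, vecMulVec_smul, smul_vecMulVec,
    smul_smul, smul_eq_mul]
  congr 2
  by_cases h : w ⬝ᵥ w = 0
  · simp [h]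
  · field_simp

theorem dotProduct_mulVec_mulVec {Q : Matrix ι ι ℝ} (hQ : Qᵀ * Q = 1) (v w : ι → ℝ) :
    (Q *ᵥ v) ⬝ᵥ (Q *ᵥ w) = v ⬝ᵥ w := by
  rw [dotProduct_mulVec, ← mulVec_transpose, mulVec_mulVec, hQ, one_mulVec]

theorem conj_hyperReflection {Q : Matrix ι ι ℝ} (hQ : Qᵀ * Q = 1) (w : ι → ℝ) :
    Q * hyperReflection w * Qᵀ = hyperReflection (Q *ᵥ w) := by
  have hQ' : Q * Qᵀ = 1 := mul_eq_one_comm.1 hQ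
  rw [hyperReflection, hyperReflection, dotProduct_mulVec_mulVec hQ, mul_sub, sub_mul, mul_one, hQ',
    mul_smul_comm, smul_mul_assoc, mul_vecMulVec, vecMulVec_mul, vecMul_transpose]

theorem hyperReflection_neg (w : ι → ℝ) : hyperReflection (-w) = hyperReflection w := by
  simp [hyperReflection]

theorem hyperReflection_single (a : ι) :
    hyperReflection (Pi.single a 1 : ι → ℝ) = diagonal fun x => if x = a then -1 else 1 := by
  ext x y
  simp only [hyperReflection, Matrix.sub_apply, Matrix.smul_apply, vecMulVec_apply,
    diagonal_apply, one_apply, Pi.single_apply, smul_eq_mul, single_dotProduct]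
  by_cases hx : x = a <;> by_cases hy : y = a <;> by_cases hxy : x = y <;> simp_all
  norm_num

/-- If the hyperplane reflections of `u` and `v`, two vectors of equal length at an angle that is not
a rational multiple of `π`, lie in a monoid, then so do those of a dense set of vectors of their
plane. Hence a quadratic inequality that holds for all `w` whose reflection is in the monoid holds on
the whole plane. -/
theorem mul_dotProduct_nonneg_of_span {G : Submonoid (Matrix ι ι ℝ)} {u v : ι → ℝ}
    (hu : u ⬝ᵥ u = 4) (hv : v ⬝ᵥ v = 4) (huv : u ⬝ᵥ v = 1)
    (hGu : hyperReflection u ∈ G) (hGv : hyperReflection v ∈ G) {x y : ι → ℝ}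
    (hxy : ∀ w, hyperReflection w ∈ G → 0 ≤ (y ⬝ᵥ w) * (x ⬝ᵥ w)) (s t : ℝ) :
    0 ≤ (y ⬝ᵥ (s • u + t • v)) * (x ⬝ᵥ (s • u + t • v)) := by
  -- `θ` is the angle between `u` and `v`: both have length 2 and their inner product is 1.
  obtain ⟨θ, hcos, hsin⟩ : ∃ θ, Real.cos θ = 1 / 4 ∧ 0 < Real.sin θ := by
    refine ⟨Real.arccos (1 / 4), Real.cos_arccos (by norm_num) (by norm_num), ?_⟩
    rw [Real.sin_arccos]
    exact Real.sqrt_pos.2 (by norm_num)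
  have hsc := Real.sin_sq_add_cos_sq θ
  rw [hcos] at hsc
  obtain ⟨p, hp⟩ : ∃ p : ι → ℝ, v = Real.cos θ • u + Real.sin θ • p := by
    refine ⟨(Real.sin θ)⁻¹ • (v - Real.cos θ • u), ?_⟩
    rw [smul_smul, mul_inv_cancel₀ hsin.ne', one_smul]
    abel
  have hup : u ⬝ᵥ p = 0 := by
    rw [hp, hcos, dotProduct_add, dotProduct_smul, dotProduct_smul, hu] at huv
    have : Real.sin θ * (u ⬝ᵥ p) = 0 := by
      simp only [smul_eq_mul] at huv; linarith
    exact (mul_eq_zero.1 this).resolve_left hsin.ne'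
  have hpu : p ⬝ᵥ u = 0 := by rw [dotProduct_comm, hup]
  have hpp : p ⬝ᵥ p = 4 := by
    rw [hp, hcos] at hv
    simp only [dotProduct_add, add_dotProduct, dotProduct_smul, smul_dotProduct, hu, hup, hpu,
      smul_eq_mul] at hv
    have : Real.sin θ ^ 2 * (p ⬝ᵥ p - 4) = 0 := by linear_combination hv - 4 * hsc
    have := (mul_eq_zero.1 this).resolve_left (by positivity)
    linarith
  -- The circle of radius 2 in the plane of `u` and `v`, with `c 0 = u` and `c θ = v`.
  let c : ℝ → ι → ℝ := fun φ => Real.cos φ • u + Real.sin φ • p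
  have hc : Continuous c := by fun_prop
  have hcc : ∀ φ ψ, c φ ⬝ᵥ c ψ = 4 * Real.cos (φ - ψ) := by
    intro φ ψ
    simp only [c, dotProduct_add, add_dotProduct, dotProduct_smul, smul_dotProduct, hu, hup, hpu,
      hpp, smul_eq_mul, Real.cos_sub]
    ring
  have hrefl : ∀ φ ψ, hyperReflection (c φ) *ᵥ c ψ = -c (2 * φ - ψ) := by
    intro φ ψ
    rw [hyperReflection_mulVec, hcc, hcc, sub_self, Real.cos_zero]
    have h1 : (2 : ℝ) / (4 * 1) * (4 * Real.cos (φ - ψ)) = 2 * Real.cos (φ - ψ) := by ring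
    rw [h1]
    have h2 : 2 * φ - ψ = φ + (φ - ψ) := by ring
    have h3 : Real.cos ψ = Real.cos (φ - (φ - ψ)) := by ring_nf
    have h4 : Real.sin ψ = Real.sin (φ - (φ - ψ)) := by ring_nf
    simp only [c]
    rw [h2, h3, h4, Real.cos_add, Real.sin_add, Real.cos_sub φ (φ - ψ), Real.sin_sub φ (φ - ψ)]
    module
  let T : Set ℝ := {φ | hyperReflection (c φ) ∈ G}
  have hT0 : 0 ∈ T := by simpa [T, c] using hGu
  have hTθ : θ ∈ T := by simpa [T, c, ← hp] using hGv
  -- Conjugating one reflection by another reflects its vector.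
  have hTrefl : ∀ φ ∈ T, ∀ ψ ∈ T, 2 * φ - ψ ∈ T := by
    intro φ hφ ψ hψ
    have : hyperReflection (c φ) * hyperReflection (c ψ) * hyperReflection (c φ) ∈ G :=
      mul_mem (mul_mem hφ hψ) hφ
    nth_rw 3 [← hyperReflection_transpose] at this
    rwa [conj_hyperReflection (by rw [hyperReflection_transpose, hyperReflection_mul_self]), hrefl,
      hyperReflection_neg] at this
  have hTneg : ∀ φ ∈ T, -φ ∈ T := fun φ hφ => by simpa using hTrefl 0 hT0 φ hφ
  have hTpi : ∀ φ ∈ T, φ + Real.pi ∈ T := by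
    intro φ hφ
    have : c (φ + Real.pi) = -c φ := by
      simp only [c, Real.cos_add_pi, Real.sin_add_pi]
      module
    simpa only [T, Set.mem_ofPred_eq, this, hyperReflection_neg] using hφ
  -- The translations that preserve `T`; as `0 ∈ T`, they all lie in `T`, so a dense subgroup
  -- suffices.
  let H : AddSubgroup ℝ :=
    { carrier := {g | ∀ φ ∈ T, φ + g ∈ T}
      zero_mem' := fun φ hφ => by simpa using hφ
      add_mem' := fun {a b} ha hb φ hφ => by rw [← add_assoc]; exact hb _ (ha _ hφ)
      neg_mem' := fun {a} ha φ hφ => by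
        have := hTneg _ (ha _ (hTneg _ hφ))
        rwa [neg_add, neg_neg] at this }
  have hH : AddSubgroup.closure {2 * θ, Real.pi} ≤ H := by
    rw [AddSubgroup.closure_le]
    rintro g (rfl | rfl)
    · intro φ hφ
      have := hTrefl θ hTθ _ (hTneg φ hφ)
      rwa [sub_neg_eq_add, add_comm] at this
    · exact hTpi
  have hirr : Irrational (2 * θ / Real.pi) := by
    rintro ⟨q, hq⟩
    have h1 : θ = ((q / 2 : ℚ) : ℝ) * Real.pi := by
      push_cast
      rw [hq]
      field_simp
    -- Niven: a rational cosine of a rational multiple of `π` is 0, ±1/2 or ±1.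
    have h2 := niven ⟨q / 2, h1⟩ ⟨1 / 4, by rw [hcos]; norm_num⟩
    rw [hcos] at h2
    norm_num at h2
  have hdense : Dense T := by
    refine (dense_addSubgroupClosure_pair_iff.2 hirr).mono fun g hg => ?_
    simpa using hH hg 0 hT0
  have hcircle : ∀ φ, 0 ≤ (y ⬝ᵥ c φ) * (x ⬝ᵥ c φ) := by
    have hcl : IsClosed {φ | 0 ≤ (y ⬝ᵥ c φ) * (x ⬝ᵥ c φ)} :=
      isClosed_le continuous_const (by fun_prop)
    intro φ
    have : closure T ⊆ {φ | 0 ≤ (y ⬝ᵥ c φ) * (x ⬝ᵥ c φ)} :=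
      closure_minimal (fun φ hφ => hxy _ hφ) hcl
    exact this (hdense φ)
  -- The coordinates of `s • u + t • v` in the orthogonal basis `u`, `p`; the polar form puts the
  -- vector on a ray through the circle.
  let z : ℂ := ⟨s + t * Real.cos θ, t * Real.sin θ⟩
  have hz : s • u + t • v = ‖z‖ • c z.arg := by
    have h1 : ‖z‖ * Real.cos z.arg = s + t * Real.cos θ := Complex.norm_mul_cos_arg z
    have h2 : ‖z‖ * Real.sin z.arg = t * Real.sin θ := Complex.norm_mul_sin_arg z
    simp only [c]
    rw [smul_add, smul_smul, smul_smul, h1, h2, hp]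
    module
  rw [hz, dotProduct_smul, dotProduct_smul, smul_eq_mul, smul_eq_mul, mul_mul_mul_comm]
  exact mul_nonneg (mul_self_nonneg _) (hcircle _)

theorem mul_eq_mul_of_nonneg {α β γ δ : ℝ}
    (h : ∀ s t : ℝ, 0 ≤ (s * α + t * β) * (s * γ + t * δ)) : α * δ = β * γ := by
  -- At this point the two linear forms take the opposite values `±(α * δ - β * γ)`.
  have h1 := h (δ + β) (-(γ + α))
  have h2 : (α * δ - β * γ) ^ 2 ≤ 0 := by nlinarith
  have h3 : α * δ - β * γ = 0 := pow_eq_zero_iff (two_ne_zero) |>.1 (le_antisymm h2 (sq_nonneg _))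
  linarith

/-- The indicator vector of a set of coordinates. -/
def indicatorVec (S : Finset ι) : ι → ℝ := fun x => if x ∈ S then 1 else 0

theorem indicatorVec_dotProduct (S T : Finset ι) :
    indicatorVec S ⬝ᵥ indicatorVec T = (S ∩ T).card := by
  simp [indicatorVec, dotProduct, ← ite_and, ← Finset.mem_inter, Finset.inter_comm]

theorem mem_orthogonalGroup_transpose_mul {Q : Matrix ι ι ℝ} (hQ : Q ∈ orthogonalGroup ι ℝ) :
    Qᵀ * Q = 1 := (mem_orthogonalGroup_iff' _ _).1 hQ

theorem isClosed_orthogonalGroup : IsClosed (orthogonalGroup ι ℝ : Set (Matrix ι ι ℝ)) :=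
  isClosed_unitary

theorem isCompact_orthogonalGroup : IsCompact (orthogonalGroup ι ℝ : Set (Matrix ι ι ℝ)) := by
  have hc : IsCompact (Set.univ.pi fun _ : ι => Set.univ.pi fun _ : ι => Set.Icc (-1 : ℝ) 1) :=
    isCompact_univ_pi fun _ => isCompact_univ_pi fun _ => isCompact_Icc
  refine IsCompact.of_isClosed_subset (X := Matrix ι ι ℝ) hc isClosed_orthogonalGroup ?_
  intro M hM a _ b _
  have h : ‖M a b‖ ≤ 1 := entry_norm_bound_of_unitary hM a b
  rw [Real.norm_eq_abs, abs_le] at h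
  exact h

/-- A monoid of orthogonal matrices that is closed under transposition and contains the signed
permutation matrices. -/
structure ContainsSignedPerms (G : Submonoid (Matrix ι ι ℝ)) : Prop where
  le_orthogonal : G ≤ orthogonalGroup ι ℝ
  transpose_mem : ∀ {M}, M ∈ G → Mᵀ ∈ G
  diagonal_mem : ∀ s : ι → ℝ, (∀ x, s x = 1 ∨ s x = -1) → diagonal s ∈ G
  perm_mem : ∀ σ : Equiv.Perm ι, Equiv.Perm.permMatrix ℝ σ ∈ G

namespace ContainsSignedPerms

variable {G : Submonoid (Matrix ι ι ℝ)}

theorem hyperReflection_mem (hG : ContainsSignedPerms G) {M : Matrix ι ι ℝ} (hM : M ∈ G) {w : ι → ℝ}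
    (hw : hyperReflection w ∈ G) : hyperReflection (M *ᵥ w) ∈ G := by
  rw [← conj_hyperReflection (mem_orthogonalGroup_transpose_mul (hG.le_orthogonal hM))]
  exact mul_mem (mul_mem hM hw) (hG.transpose_mem hM)

theorem hyperReflection_indicatorVec_mem (hG : ContainsSignedPerms G) {S T : Finset ι}
    (hST : S.card = T.card) (hS : hyperReflection (indicatorVec S) ∈ G) : hyperReflection (indicatorVec T) ∈ G := by
  -- Any bijection between the two sets extends to a permutation of all coordinates.
  let e : {x // x ∈ T} ≃ {x // x ∈ S} := Fintype.equivOfCardEq (by simp [hST])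
  have := hG.hyperReflection_mem (hG.perm_mem e.extendSubtype) hS
  rw [permMatrix_mulVec] at this
  convert! this using 2
  ext1 x
  simp only [indicatorVec, Function.comp]
  refine if_congr ⟨fun h => e.extendSubtype_mem x h, fun h => ?_⟩ rfl rfl
  by_contra h'
  exact e.extendSubtype_not_mem x h' h

theorem hyperReflection_single_add_mem (hG : ContainsSignedPerms G) {S T : Finset ι}
    (hS : hyperReflection (indicatorVec S) ∈ G)
    (hST : S.card = T.card + 1) {a : ι} (ha : a ∉ T) {ε : ℝ} (hε : ε = 1 ∨ ε = -1) :
    hyperReflection (ε • Pi.single a 1 + indicatorVec T) ∈ G := by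
  have h1 := hG.hyperReflection_indicatorVec_mem (T := insert a T)
    (by rw [hST, Finset.card_insert_of_notMem ha]) hS
  have h2 := hG.hyperReflection_mem (hG.diagonal_mem (fun x => if x = a then ε else 1)
    fun x => by split_ifs <;> simp [hε]) h1
  convert! h2 using 2
  ext1 x
  rw [mulVec_diagonal]
  by_cases hx : x = a
  · subst hx; simp [indicatorVec, ha]
  · simp [indicatorVec, hx]

/-- On the plane of `± e_a + 1_{T₁}` and `± e_b + 1_{T₂}` the product of the forms given by `x` and
`y` has constant sign, so the forms are proportional there. Varying the signs isolates the
coordinates `a` and `b`. -/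
theorem mul_apply_eq (hG : ContainsSignedPerms G) {S : Finset ι}
    (hcard : 7 ≤ Fintype.card ι) (hS4 : S.card = 4)
    (hS : hyperReflection (indicatorVec S) ∈ G) {x y : ι → ℝ}
    (hxy : ∀ w, hyperReflection w ∈ G → 0 ≤ (y ⬝ᵥ w) * (x ⬝ᵥ w)) (a b : ι) :
    y a * x b = y b * x a := by
  rcases eq_or_ne a b with rfl | hab
  · rfl
  -- Two triples sharing one point occupy five coordinates; with `a` and `b` this needs seven.
  obtain ⟨T, hT, hT5⟩ : ∃ T ⊆ Finset.univ \ {a, b}, T.card = 5 := by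
    refine Finset.exists_subset_card_eq ?_
    rw [Finset.card_sdiff_of_subset (Finset.subset_univ _), Finset.card_pair hab, Finset.card_univ]
    omega
  obtain ⟨T₁, hT₁, hT₁3⟩ : ∃ T₁ ⊆ T, T₁.card = 3 := Finset.exists_subset_card_eq (by omega)
  obtain ⟨c, hc⟩ : T₁.Nonempty := Finset.card_pos.1 (by omega)
  let T₂ := insert c (T \ T₁)
  have hT₂3 : T₂.card = 3 := by
    rw [Finset.card_insert_of_notMem (by simp [hc]), Finset.card_sdiff_of_subset hT₁]
    omega
  have hT₂ : T₂ ⊆ T := Finset.insert_subset (hT₁ hc) Finset.sdiff_subset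
  have hinter : T₁ ∩ T₂ = {c} := by
    ext z
    simp only [T₂, Finset.mem_inter, Finset.mem_insert, Finset.mem_sdiff, Finset.mem_singleton]
    constructor
    · tauto
    · rintro rfl
      tauto
  have ha : a ∉ T := fun h => by simpa using hT h
  have hb : b ∉ T := fun h => by simpa using hT h
  have ha1 : a ∉ T₁ := fun h => ha (hT₁ h)
  have ha2 : a ∉ T₂ := fun h => ha (hT₂ h)
  have hb1 : b ∉ T₁ := fun h => hb (hT₁ h)
  have hb2 : b ∉ T₂ := fun h => hb (hT₂ h)
  have key : ∀ ε ε' : ℝ, (ε = 1 ∨ ε = -1) → (ε' = 1 ∨ ε' = -1) →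
      (ε * y a + y ⬝ᵥ indicatorVec T₁) * (ε' * x b + x ⬝ᵥ indicatorVec T₂) =
        (ε' * y b + y ⬝ᵥ indicatorVec T₂) * (ε * x a + x ⬝ᵥ indicatorVec T₁) := by
    intro ε ε' hε hε'
    have h1 := hG.hyperReflection_single_add_mem hS (by omega) ha1 hε
    have h2 := hG.hyperReflection_single_add_mem hS (by omega) hb2 hε'
    have e1 : ε * ε = 1 := by rcases hε with rfl | rfl <;> norm_num
    have e2 : ε' * ε' = 1 := by rcases hε' with rfl | rfl <;> norm_num
    have hdot : ∀ (z z' : ι) (R R' : Finset ι) (η η' : ℝ),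
        (η • Pi.single z 1 + indicatorVec R) ⬝ᵥ (η' • Pi.single z' 1 + indicatorVec R') =
          η * η' * (if z' = z then 1 else 0) + η * (if z ∈ R' then 1 else 0) +
            η' * (if z' ∈ R then 1 else 0) + (R ∩ R').card := by
      intro z z' R R' η η'
      rw [dotProduct_add, add_dotProduct, add_dotProduct, indicatorVec_dotProduct]
      simp only [smul_dotProduct, dotProduct_smul, single_one_dotProduct, dotProduct_single_one,
        indicatorVec, smul_eq_mul, Pi.smul_apply, Pi.single_apply]
      ring
    have h3 := mul_dotProduct_nonneg_of_span
      (by rw [hdot, if_pos rfl, if_neg ha1, Finset.inter_self, hT₁3, e1]; norm_num)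
      (by rw [hdot, if_pos rfl, if_neg hb2, Finset.inter_self, hT₂3, e2]; norm_num)
      (by rw [hdot, if_neg hab.symm, if_neg ha2, if_neg hb1, hinter, Finset.card_singleton]; norm_num)
      h1 h2 hxy
    apply mul_eq_mul_of_nonneg
    intro s t
    have := h3 s t
    simpa [mul_add] using this
  have k1 := key 1 1 (by simp) (by simp)
  have k2 := key 1 (-1) (by simp) (by simp)
  have k3 := key (-1) 1 (by simp) (by simp)
  have k4 := key (-1) (-1) (by simp) (by simp)
  -- The alternating sum keeps only the terms with coefficient `ε * ε'`.
  linear_combination (k1 - k2 - k3 + k4) / 4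

end ContainsSignedPerms

end Reflections

/-! ### Transitivity of the closure on the sphere -/

namespace ContainsSignedPerms

variable {ι : Type*} [Fintype ι] [DecidableEq ι] {G : Submonoid (Matrix ι ι ℝ)}

theorem closure_le_orthogonalGroup (hG : ContainsSignedPerms G) :
    G.topologicalClosure ≤ orthogonalGroup ι ℝ :=
  Submonoid.topologicalClosure_minimal _ hG.le_orthogonal isClosed_orthogonalGroup

theorem transpose_mem_closure (hG : ContainsSignedPerms G) {M : Matrix ι ι ℝ}
    (hM : M ∈ G.topologicalClosure) : Mᵀ ∈ G.topologicalClosure :=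
  map_mem_closure (f := fun M : Matrix ι ι ℝ => Mᵀ) (by fun_prop) hM
    fun _ h => hG.transpose_mem h

/-- The closure of `G` acts transitively on the unit sphere. -/
theorem exists_mulVec_single_eq (hG : ContainsSignedPerms G) {S : Finset ι}
    (hcard : 7 ≤ Fintype.card ι) (hS4 : S.card = 4) (hS : hyperReflection (indicatorVec S) ∈ G)
    (a : ι) {x : ι → ℝ} (hx : x ⬝ᵥ x = 1) :
    ∃ k ∈ G.topologicalClosure, k *ᵥ Pi.single a 1 = x := by
  have hcomp : IsCompact (G.topologicalClosure : Set (Matrix ι ι ℝ)) :=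
    isCompact_orthogonalGroup.of_isClosed_subset G.isClosed_topologicalClosure
      hG.closure_le_orthogonalGroup
  -- Among unit vectors, a largest inner product with `x` means a smallest distance to `x`.
  obtain ⟨k, hk, hmax⟩ := hcomp.exists_isMaxOn ⟨1, one_mem G.topologicalClosure⟩
    (f := fun M : Matrix ι ι ℝ => x ⬝ᵥ (M *ᵥ Pi.single a 1)) (by fun_prop)
  set y := k *ᵥ Pi.single a 1 with hy
  have hyy : y ⬝ᵥ y = 1 := by
    rw [hy, dotProduct_mulVec_mulVec
      (mem_orthogonalGroup_transpose_mul (hG.closure_le_orthogonalGroup hk))]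
    simp
  have hxy : ∀ w, hyperReflection w ∈ G → 0 ≤ (y ⬝ᵥ w) * (x ⬝ᵥ w) := by
    intro w hw
    -- Replacing `k` by `hyperReflection w * k` cannot improve the maximum.
    have h1 : x ⬝ᵥ ((hyperReflection w * k) *ᵥ Pi.single a 1) ≤ x ⬝ᵥ y :=
      hmax (mul_mem (G.le_topologicalClosure hw) hk)
    rw [← mulVec_mulVec, ← hy, hyperReflection_mulVec, dotProduct_sub, dotProduct_smul,
      smul_eq_mul, dotProduct_comm w y] at h1
    rcases eq_or_ne (w ⬝ᵥ w) 0 with h0 | h0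
    · rw [dotProduct_self_eq_zero.1 h0]
      simp
    · have hpos : 0 < w ⬝ᵥ w := lt_of_le_of_ne
        (Finset.sum_nonneg fun _ _ => mul_self_nonneg _) h0.symm
      have h2 : 0 ≤ 2 / (w ⬝ᵥ w) * ((y ⬝ᵥ w) * (x ⬝ᵥ w)) := by linarith
      exact nonneg_of_mul_nonneg_right h2 (by positivity)
  have hpar := hG.mul_apply_eq hcard hS4 hS hxy
  have hxe : x = (x ⬝ᵥ y) • y := by
    ext1 b
    rw [Pi.smul_apply, smul_eq_mul, dotProduct, Finset.sum_mul]
    calc x b = ∑ c, y c * y c * x b := by rw [← Finset.sum_mul, ← dotProduct, hyy, one_mul]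
      _ = _ := Finset.sum_congr rfl fun c _ => by rw [mul_assoc, hpar c b]; ring
  have hsq : (x ⬝ᵥ y) * (x ⬝ᵥ y) = 1 := by
    have := hx
    rw [hxe, smul_dotProduct, dotProduct_smul, hyy] at this
    simpa using this
  rcases mul_self_eq_one_iff.1 hsq with h | h
  · exact ⟨k, hk, by rw [← hy, hxe, h, one_smul]⟩
  · refine ⟨diagonal (fun _ => -1) * k,
      mul_mem (G.le_topologicalClosure (hG.diagonal_mem _ fun _ => Or.inr rfl)) hk, ?_⟩
    rw [← mulVec_mulVec, ← hy, hxe, h]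
    ext1 b
    simp [mulVec_diagonal]

/-- By transitivity, every reflection with nonzero vector is conjugate in the closure to a
coordinate reflection, which is a sign matrix. -/
theorem hyperReflection_mem_closure (hG : ContainsSignedPerms G) {S : Finset ι}
    (hcard : 7 ≤ Fintype.card ι) (hS4 : S.card = 4) (hS : hyperReflection (indicatorVec S) ∈ G)
    (x : ι → ℝ) : hyperReflection x ∈ G.topologicalClosure := by
  rcases eq_or_ne (x ⬝ᵥ x) 0 with h0 | h0
  · rw [hyperReflection, h0]
    simp
  have hpos : 0 < x ⬝ᵥ x := lt_of_le_of_ne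
    (Finset.sum_nonneg fun _ _ => mul_self_nonneg _) h0.symm
  have hr : (√(x ⬝ᵥ x))⁻¹ ≠ 0 := inv_ne_zero (Real.sqrt_pos.2 hpos).ne'
  obtain ⟨a⟩ : Nonempty ι := Fintype.card_pos_iff.1 (by omega)
  obtain ⟨k, hk, hkx⟩ := hG.exists_mulVec_single_eq hcard hS4 hS a
    (x := (√(x ⬝ᵥ x))⁻¹ • x) (by
      rw [smul_dotProduct, dotProduct_smul, smul_eq_mul, smul_eq_mul, ← mul_assoc, ← mul_inv,
        Real.mul_self_sqrt hpos.le, inv_mul_cancel₀ h0])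
  rw [← hyperReflection_smul hr, ← hkx, ← conj_hyperReflection
    (mem_orthogonalGroup_transpose_mul (hG.closure_le_orthogonalGroup hk)), hyperReflection_single]
  exact mul_mem (mul_mem hk (G.le_topologicalClosure (hG.diagonal_mem _ fun x => by
    split_ifs <;> simp))) (hG.transpose_mem_closure hk)

end ContainsSignedPerms

/-! ### Reflections generate the orthogonal group -/

section Generation

variable {ι : Type*} [Fintype ι] [DecidableEq ι]

theorem orthogonalGroup_le_of_hyperReflection_mem {K : Submonoid (Matrix ι ι ℝ)}
    (hK : ∀ w, hyperReflection w ∈ K) : orthogonalGroup ι ℝ ≤ K := by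
  -- Cartan–Dieudonné by induction on a set `s` outside which `Q` fixes all coordinate vectors.
  have key : ∀ (s : Finset ι) (Q : Matrix ι ι ℝ), Qᵀ * Q = 1 →
      (∀ b ∉ s, Q *ᵥ Pi.single b 1 = Pi.single b 1) → Q ∈ K := by
    intro s
    induction s using Finset.induction_on with
    | empty =>
      intro Q _ h
      have : Q = 1 := by
        ext a b
        have := congrFun (h b (by simp)) a
        rwa [mulVec_single_one, col_apply, Pi.single_apply, ← one_apply] at this
      rw [this]
      exact one_mem K
    | insert a s ha ih =>
      intro Q hQ h
      set e : ι → ℝ := Pi.single a 1 with he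
      have hee : e ⬝ᵥ e = 1 := by simp [he]
      have hQe : (Q *ᵥ e) ⬝ᵥ (Q *ᵥ e) = 1 := by rw [dotProduct_mulVec_mulVec hQ, hee]
      -- The reflection of `w` sends `Q *ᵥ e` back to `e`. It keeps each coordinate vector already
      -- fixed by `Q`, because such a vector is orthogonal to `w`.
      set w := Q *ᵥ e - e with hw
      have hR : hyperReflection w * Q ∈ K := by
        refine ih _ ?_ fun b hb => ?_
        · rw [transpose_mul, hyperReflection_transpose, mul_assoc, ← mul_assoc (hyperReflection w),
            hyperReflection_mul_self, one_mul, hQ]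
        · rw [← mulVec_mulVec]
          rcases eq_or_ne b a with rfl | hba
          · rw [← he, hyperReflection_mulVec]
            rcases eq_or_ne (w ⬝ᵥ w) 0 with h0 | h0
            · have := dotProduct_self_eq_zero.1 h0
              rw [this]
              rw [this] at hw
              rw [smul_zero, sub_zero]
              exact (sub_eq_zero.1 hw.symm)
            · have h1 : w ⬝ᵥ w = 2 * (w ⬝ᵥ (Q *ᵥ e)) := by
                rw [hw]
                simp only [sub_dotProduct, dotProduct_sub, hQe, hee, dotProduct_comm e (Q *ᵥ e)]
                ring
              have h2 : 2 / (w ⬝ᵥ w) * (w ⬝ᵥ (Q *ᵥ e)) = 1 := by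
                rw [div_mul_eq_mul_div, ← h1, div_self h0]
              rw [h2, one_smul, hw]
              abel
          · have hQb := h b (by simp [hba, hb])
            have h1 : w ⬝ᵥ Pi.single b 1 = 0 := by
              rw [hw, sub_dotProduct]
              nth_rw 1 [← hQb]
              rw [dotProduct_mulVec_mulVec hQ, sub_self]
            rw [hQb, hyperReflection_mulVec, h1, mul_zero, zero_smul, sub_zero]
      have := mul_mem (hK w) hR
      rwa [← mul_assoc, hyperReflection_mul_self, one_mul] at this
  exact fun Q hQ => key Finset.univ Q (mem_orthogonalGroup_transpose_mul hQ)
    fun b hb => absurd (Finset.mem_univ b) hb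

theorem ContainsSignedPerms.closure_eq {G : Submonoid (Matrix ι ι ℝ)}
    (hG : ContainsSignedPerms G) {S : Finset ι} (hcard : 7 ≤ Fintype.card ι) (hS4 : S.card = 4)
    (hS : hyperReflection (indicatorVec S) ∈ G) :
    closure (G : Set (Matrix ι ι ℝ)) = (orthogonalGroup ι ℝ : Set (Matrix ι ι ℝ)) :=
  subset_antisymm hG.closure_le_orthogonalGroup
    (orthogonalGroup_le_of_hyperReflection_mem (K := G.topologicalClosure)
      (hG.hyperReflection_mem_closure hcard hS4 hS))

end Generation

/-! ### Density of the words -/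

section Density

variable {n : ℕ} [NeZero n] {i : Basis n} {j : Fin n}

theorem words_containsSignedPerms : ContainsSignedPerms (words (alphabet n i j)) where
  le_orthogonal := words_le_orthogonalGroup
  transpose_mem := transpose_mem_words
  diagonal_mem := diagonal_sign_mem
  perm_mem := permMatrix_mem

/-- Two Hadamard gates turn a basis vector into a vector with four equal entries. -/
theorem exists_hyperReflection_indicatorVec_mem (hn : 2 ≤ n) :
    ∃ S : Finset (Basis n), S.card = 4 ∧
      hyperReflection (indicatorVec S) ∈ words (alphabet n i j) := by
  have : Nontrivial (Fin n) := Fin.nontrivial_iff_two_le.2 hn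
  obtain ⟨k, l, hkl⟩ := exists_pair_ne (Fin n)
  let M : Gate n := onQubit k hadamard * onQubit l hadamard
  have hM : M ∈ words (alphabet n i j) := mul_mem (hadamard_mem k) (hadamard_mem l)
  let S : Finset (Basis n) := Finset.univ.filter fun x => ∀ m, m ≠ k → m ≠ l → x m = 0
  have hcol : M *ᵥ Pi.single 0 1 = (1 / 2 : ℝ) • indicatorVec S := by
    ext1 x
    rw [mulVec_single_one, col_apply]
    simp only [M, onQubit, tensor_mul, tensor_apply, Pi.smul_apply, indicatorVec, smul_eq_mul]
    by_cases hx : x ∈ S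
    · rw [if_pos hx]
      have hx' : ∀ m, m ≠ k → m ≠ l → x m = 0 := by simpa [S] using hx
      rw [← Finset.prod_subset (Finset.subset_univ {k, l})]
      · have hH : ∀ c : Fin 2, hadamard c 0 = (√2)⁻¹ := by
          intro c
          fin_cases c <;> simp [hadamard]
        rw [Finset.prod_pair hkl]
        simp only [update_self, update_of_ne hkl, update_of_ne hkl.symm, mul_one, one_mul,
          Pi.zero_apply, hH, ← mul_inv]
        norm_num
      · intro m _ hm
        simp only [Finset.mem_insert, Finset.mem_singleton, not_or] at hm
        simp [hm, hx' m hm.1 hm.2]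
    · rw [if_neg hx, mul_zero]
      simp only [S, Finset.mem_filter, Finset.mem_univ, true_and, not_forall] at hx
      obtain ⟨m, hmk, hml, hm⟩ := hx
      refine Finset.prod_eq_zero (Finset.mem_univ m) ?_
      simp [hmk, hml, hm]
  have hG := words_containsSignedPerms (i := i) (j := j)
  refine ⟨S, ?_, ?_⟩
  · have h1 := dotProduct_mulVec_mulVec (mem_orthogonalGroup_transpose_mul (hG.le_orthogonal hM))
      (Pi.single 0 1) (Pi.single 0 1)
    rw [hcol, smul_dotProduct, dotProduct_smul, indicatorVec_dotProduct, Finset.inter_self] at h1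
    simp only [smul_eq_mul, single_one_dotProduct, Pi.single_eq_same] at h1
    have h2 : (S.card : ℝ) = 4 := by linarith
    exact_mod_cast h2
  · rw [← hyperReflection_smul (r := 1 / 2) (by norm_num), ← hcol]
    refine hG.hyperReflection_mem hM ?_
    rw [hyperReflection_single]
    exact phaseFlip_mem 0

theorem closure_words (hn : 3 ≤ n) :
    closure (words (alphabet n i j) : Set (Gate n)) =
      (orthogonalGroup (Basis n) ℝ : Set (Gate n)) := by
  obtain ⟨S, hS4, hS⟩ := exists_hyperReflection_indicatorVec_mem (i := i) (j := j) (by omega)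
  refine words_containsSignedPerms.closure_eq ?_ hS4 hS
  rw [Fintype.card_fun, Fintype.card_fin, Fintype.card_fin]
  calc 7 ≤ 2 ^ 3 := by norm_num
    _ ≤ 2 ^ n := Nat.pow_le_pow_right (by norm_num) hn

end Density

/-! ### Complex unitaries as real orthogonal matrices -/

section Simulation

variable {n : ℕ} (a : Fin n)

theorem sum_basis_eq (f : Fin 2 → Rest a → ℝ) :
    ∑ y : Basis n, f (y a) (fun l => y l) = ∑ r, (f 0 r + f 1 r) := by
  rw [Finset.sum_add_distrib, ← Fin.sum_univ_two (fun b => ∑ r, f b r), ← Fintype.sum_prod_type',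
    ← (Equiv.funSplitAt a (Fin 2)).sum_comp]
  rfl

/-- The real matrix that represents a complex one in the encoding `encode a`. -/
def realify (U : Matrix (Rest a) (Rest a) ℂ) : Gate n :=
  Matrix.of fun x y =>
    if x a = 0 then
      if y a = 0 then (U (fun l => x l) fun l => y l).re else -(U (fun l => x l) fun l => y l).im
    else if y a = 0 then (U (fun l => x l) fun l => y l).im else (U (fun l => x l) fun l => y l).re

theorem realify_mulVec_encode (U : Matrix (Rest a) (Rest a) ℂ) (ψ : Rest a → ℂ) :
    realify a U *ᵥ encode a ψ = encode a (U *ᵥ ψ) := by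
  ext1 x
  rw [mulVec, dotProduct]
  simp only [realify, encode, Matrix.of_apply]
  rw [sum_basis_eq a fun b r => (if x a = 0 then
      if b = 0 then (U (fun l => x l) r).re else -(U (fun l => x l) r).im
    else if b = 0 then (U (fun l => x l) r).im else (U (fun l => x l) r).re) *
      if b = 0 then (ψ r).re else (ψ r).im]
  simp only [mulVec, dotProduct, Complex.re_sum, Complex.im_sum, Complex.mul_re, Complex.mul_im]
  simp only [if_true, one_ne_zero, if_false]
  split_ifs <;> exact Finset.sum_congr rfl fun r _ => by ring

theorem realify_mul (U U' : Matrix (Rest a) (Rest a) ℂ) :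
    realify a U * realify a U' = realify a (U * U') := by
  ext x z
  rw [mul_apply]
  simp only [realify, Matrix.of_apply]
  rw [sum_basis_eq a fun b r => (if x a = 0 then
      if b = 0 then (U (fun l => x l) r).re else -(U (fun l => x l) r).im
    else if b = 0 then (U (fun l => x l) r).im else (U (fun l => x l) r).re) *
      if b = 0 then if z a = 0 then (U' r fun l => z l).re else -(U' r fun l => z l).im
    else if z a = 0 then (U' r fun l => z l).im else (U' r fun l => z l).re]
  simp only [mul_apply, Complex.re_sum, Complex.im_sum, Complex.mul_re, Complex.mul_im]
  simp only [if_true, one_ne_zero, if_false, ← Finset.sum_neg_distrib]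
  split_ifs <;> exact Finset.sum_congr rfl fun r _ => by ring

theorem realify_one : realify a 1 = 1 := by
  ext x y
  have h : x = y ↔ x a = y a ∧ (fun l : {l // l ≠ a} => x l) = fun l : {l // l ≠ a} => y l := by
    refine ⟨by rintro rfl; exact ⟨rfl, rfl⟩, ?_⟩
    rintro ⟨h1, h2⟩
    ext1 l
    by_cases hl : l = a
    · rw [hl, h1]
    · exact congrFun h2 ⟨l, hl⟩
  simp only [realify, Matrix.of_apply, one_apply, h]
  generalize x a = b
  generalize y a = c
  by_cases hr : (fun l : {l // l ≠ a} => x l) = fun l : {l // l ≠ a} => y l <;>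
    fin_cases b <;> fin_cases c <;> simp [hr]

theorem realify_transpose (U : Matrix (Rest a) (Rest a) ℂ) :
    (realify a U)ᵀ = realify a Uᴴ := by
  ext x y
  simp only [transpose_apply, realify, Matrix.of_apply, conjTranspose_apply, RCLike.star_def,
    Complex.conj_re, Complex.conj_im, neg_neg]
  split_ifs <;> rfl

/-- `realify` is multiplicative and unital and turns the adjoint into the transpose. -/
theorem realify_mem_orthogonalGroup {U : Matrix (Rest a) (Rest a) ℂ}
    (hU : U ∈ unitaryGroup (Rest a) ℂ) : realify a U ∈ orthogonalGroup (Basis n) ℝ := by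
  rw [mem_orthogonalGroup_iff, realify_transpose, realify_mul, ← star_eq_conjTranspose,
    mem_unitaryGroup_iff.1 hU, realify_one]

theorem sum_encode_sq (ψ : Rest a → ℂ) : ∑ x, encode a ψ x ^ 2 = ∑ r, ‖ψ r‖ ^ 2 := by
  simp only [encode]
  rw [sum_basis_eq a fun b r => (if b = 0 then (ψ r).re else (ψ r).im) ^ 2]
  refine Finset.sum_congr rfl fun r _ => ?_
  rw [← Complex.normSq_eq_norm_sq, Complex.normSq_apply]
  simp
  ring

theorem simulatesUnitaries_of_closure_eq {S : Set (Gate n)}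
    (h : closure (words S : Set (Gate n)) = (orthogonalGroup (Basis n) ℝ : Set (Gate n))) :
    SimulatesUnitaries S := by
  intro a U hU ε hε
  let Q := realify a U
  have hQ : Q ∈ closure (words S : Set (Gate n)) := by
    rw [h]
    exact realify_mem_orthogonalGroup a hU
  let N : ℝ := Fintype.card (Basis n)
  have hN : 0 < N := Nat.cast_pos.2 Fintype.card_pos
  -- With entrywise error `ε / N`, Cauchy–Schwarz bounds the squared error by `N * N * (ε / N) ^ 2 =
  -- ε ^ 2` times the squared norm.
  let O : Set (Gate n) := {M | ∀ x y, |M x y - Q x y| < ε / N}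
  have hO : IsOpen O := by
    have : O = ⋂ x, ⋂ y, {M : Gate n | |M x y - Q x y| < ε / N} := by
      ext M
      simp [O]
    rw [this]
    refine isOpen_iInter_of_finite fun x => isOpen_iInter_of_finite fun y => ?_
    exact isOpen_lt (by fun_prop) continuous_const
  obtain ⟨W, hWO, hW⟩ := mem_closure_iff.1 hQ O hO fun x y => by
    rw [sub_self, abs_zero]
    positivity
  refine ⟨W, hW, fun ψ => ?_⟩
  rw [← realify_mulVec_encode, ← sum_encode_sq]
  set v := encode a ψ
  calc ∑ x, ((W *ᵥ v) x - (Q *ᵥ v) x) ^ 2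
      = ∑ x, (∑ y, (W x y - Q x y) * v y) ^ 2 := by
        simp only [mulVec, dotProduct, sub_mul, Finset.sum_sub_distrib]
    _ ≤ ∑ x : Basis n, (∑ _y : Basis n, (ε / N) ^ 2) * ∑ y, v y ^ 2 := by
        refine Finset.sum_le_sum fun x _ => (Finset.sum_mul_sq_le_sq_mul_sq _ _ _).trans ?_
        refine mul_le_mul_of_nonneg_right (Finset.sum_le_sum fun y _ => ?_)
          (Finset.sum_nonneg fun _ _ => sq_nonneg _)
        rw [← sq_abs]
        exact pow_le_pow_left₀ (abs_nonneg _) (hWO x y).le 2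
    _ = ε ^ 2 * ∑ y, v y ^ 2 := by
        simp only [Finset.sum_const, Finset.card_univ, nsmul_eq_mul]
        change N * (N * (ε / N) ^ 2 * _) = _
        field_simp

end Simulation

end UnlabeledQubits

end

theorem theorem1 (n : ℕ) [NeZero n] (i : UnlabeledQubits.Basis n) (j : Fin n) :
    -- `Vₙ` is an `n`-th root of `H ⊗ ⋯ ⊗ H`
    UnlabeledQubits.V n ^ n = UnlabeledQubits.tensor (fun _ : Fin n => UnlabeledQubits.hadamard) ∧
    -- the letters are real orthogonal, and there are three of them (for `n ≥ 2`)
    UnlabeledQubits.alphabet n i j ⊆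
      (Matrix.orthogonalGroup (UnlabeledQubits.Basis n) ℝ : Set (UnlabeledQubits.Gate n)) ∧
    (2 ≤ n → (UnlabeledQubits.alphabet n i j).ncard = 3) ∧
    -- the words contain all diagonal sign matrices and all permutation matrices
    (∀ s : UnlabeledQubits.Basis n → ℝ, (∀ x, s x = 1 ∨ s x = -1) →
      Matrix.diagonal s ∈ UnlabeledQubits.words (UnlabeledQubits.alphabet n i j)) ∧
    (∀ σ : Equiv.Perm (UnlabeledQubits.Basis n),
      Equiv.Perm.permMatrix ℝ σ ∈ UnlabeledQubits.words (UnlabeledQubits.alphabet n i j)) ∧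
    -- every Hadamard-Toffoli circuit on `n` qubits is a word, exactly
    UnlabeledQubits.words (UnlabeledQubits.hadamardToffoli n) ≤
      UnlabeledQubits.words (UnlabeledQubits.alphabet n i j) ∧
    -- universality: the words are dense in the real orthogonal group, and simulate all unitaries
    (3 ≤ n →
      closure (UnlabeledQubits.words (UnlabeledQubits.alphabet n i j) :
          Set (UnlabeledQubits.Gate n)) =
        (Matrix.orthogonalGroup (UnlabeledQubits.Basis n) ℝ : Set (UnlabeledQubits.Gate n)) ∧
      UnlabeledQubits.SimulatesUnitaries (UnlabeledQubits.alphabet n i j)) := by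
  exact ⟨UnlabeledQubits.V_pow_self, UnlabeledQubits.alphabet_subset_orthogonalGroup,
    UnlabeledQubits.alphabet_ncard, UnlabeledQubits.diagonal_sign_mem,
    UnlabeledQubits.permMatrix_mem, UnlabeledQubits.words_hadamardToffoli_le,
    fun hn => ⟨UnlabeledQubits.closure_words hn,
      UnlabeledQubits.simulatesUnitaries_of_closure_eq (UnlabeledQubits.closure_words hn)⟩⟩
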